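/- Let $H\in\mathbb{C}^{n\times n}$ be an invertible Hermitian matrix and put $[x,y]=(Hx,y)$ for $x,y\in\mathbb{C}^n$, where $(\cdot,\cdot)$ is the Euclidean inner product. A matrix $A\in\mathbb{C}^{n\times n}$ is called $H$-selfadjoint if $HA=A^*H$, and $B\in\mathbb{C}^{n\times n}$ is called $H$-nonnegative if $[Bx,x]\ge 0$ for all $x\in\mathbb{C}^n$. Let $J_k(\lambda)$ denote the $k\times k$ Jordan block with eigenvalue $\lambda$, and $Q_k$ the $k\times k$ matrix with ones on the main anti-diagonal and zeros elsewhere. A canonical form of the pair $(B,H)$ consists of the block matrices $$S^{-1}BS=\bigoplus_{i=1}^{\alpha}J_{k_i}(\lambda_i)\oplus\bigoplus_{j=\alpha+1}^{\beta}\bigl[J_{k_j}(\lambda_j)\oplus J_{k_j}(\overline{\lambda}_j)\bigr],\qquad S^*HS=\bigoplus_{i=1}^{\alpha}\varepsilon_iQ_{k_i}\oplus\bigoplus_{j=\alpha+1}^{\beta}Q_{2k_j}$$ with $S$ invertible, $\lambda_1,\dots,\lambda_\alpha$ real, $\varepsilon_i=\pm1$, and $\lambda_{\alpha+1},\dots,\lambda_\beta$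 with positive imaginary part; $\varepsilon_i$ is the sign characteristic of the block $J_{k_i}(\lambda_i)$. Theorem. Let $B\in\mathbb{C}^{n\times n}$ be $H$-nonnegative. Then $(B,H)$ has a canonical form. Moreover, for every canonical form of $(B,H)$, let $s_+$ be the number of its $1\times1$ Jordan blocks at the eigenvalue $0$ with sign characteristic $+1$, and let $t$ be the number of its $2\times 2$ Jordan blocks at the eigenvalue $0$. Then there exists an $H$-selfadjoint matrix $A$ with $A^2=B$ if and only if both of the following hold: (i) $\sigma(B)\subset[0,\infty)$; (ii) $s_+\ge t$. -/

import Mathlib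

open Matrix
open scoped ComplexOrder

/-- The indefinite inner product `[x, y] = (H x, y)` on `ℂⁿ`, where `(u, v) = ∑ uᵢ conj vᵢ` is the
usual Euclidean inner product, linear in its first argument. -/
def indefInner {n : ℕ} (H : Matrix (Fin n) (Fin n) ℂ) (x y : Fin n → ℂ) : ℂ :=
  (H *ᵥ x) ⬝ᵥ star y

/-- `B` is `H`-selfadjoint: `H B = B* H`, that is, `[B x, y] = [x, B y]` for all `x`, `y`. -/
def IsHSelfadjoint {n : ℕ} (H B : Matrix (Fin n) (Fin n) ℂ) : Prop :=
  H * B = Bᴴ * H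

/-- `B` is `H`-nonnegative: `[B x, x] ≥ 0` for all `x`. In the order of `ℂ` used here, `0 ≤ z` means
that `z` is real and nonnegative. -/
def IsHNonneg {n : ℕ} (H B : Matrix (Fin n) (Fin n) ℂ) : Prop :=
  ∀ x : Fin n → ℂ, 0 ≤ indefInner H (B *ᵥ x) x

/-- The `k × k` upper triangular Jordan block `J_k(μ)`. -/
def jordanBlock (k : ℕ) (μ : ℂ) : Matrix (Fin k) (Fin k) ℂ :=
  Matrix.of fun i j => if i = j then μ else if (i : ℕ) + 1 = (j : ℕ) then 1 else 0

/-- The `k × k` sip matrix `Q_k`: ones on the main anti-diagonal and zeros elsewhere. -/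
def sipMatrix (k : ℕ) : Matrix (Fin k) (Fin k) ℂ :=
  Matrix.of fun i j => if (i : ℕ) + (j : ℕ) + 1 = k then 1 else 0

/-- The combinatorial data of a canonical form of a pair `(B, H)`, with `B` an `H`-selfadjoint
matrix: finitely many Jordan blocks `J_{size i}(eig i)` with real eigenvalue, each with a sign
`sign i = ±1`, and finitely many pairs `J_{csize j}(ceig j) ⊕ J_{csize j}(conj (ceig j))` with
`ceig j` in the open upper half plane, which have no sign. -/
structure CanonicalData where
  numReal : ℕ
  size : Fin numReal → ℕ
  size_pos : ∀ i, 0 < size i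
  eig : Fin numReal → ℝ
  sign : Fin numReal → ℤˣ
  numPairs : ℕ
  csize : Fin numPairs → ℕ
  csize_pos : ∀ j, 0 < csize j
  ceig : Fin numPairs → ℂ
  ceig_im_pos : ∀ j, 0 < (ceig j).im

namespace CanonicalData

/-- The index set of the rows and columns of the canonical form. -/
abbrev Idx (D : CanonicalData) : Type :=
  (Σ i : Fin D.numReal, Fin (D.size i)) ⊕
    (Σ j : Fin D.numPairs, Fin (D.csize j) ⊕ Fin (D.csize j))

/-- The Jordan matrix
`⨁ᵢ J_{size i}(eig i) ⊕ ⨁ⱼ [J_{csize j}(ceig j) ⊕ J_{csize j}(conj (ceig j))]`. -/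
def jordan (D : CanonicalData) : Matrix D.Idx D.Idx ℂ :=
  Matrix.fromBlocks
    (Matrix.blockDiagonal' fun i => jordanBlock (D.size i) (D.eig i : ℂ)) 0 0
    (Matrix.blockDiagonal' fun j =>
      Matrix.fromBlocks (jordanBlock (D.csize j) (D.ceig j)) 0 0
        (jordanBlock (D.csize j) (star (D.ceig j))))

/-- The Gram matrix `⨁ᵢ (sign i) Q_{size i} ⊕ ⨁ⱼ Q_{2 csize j}`. -/
def gram (D : CanonicalData) : Matrix D.Idx D.Idx ℂ :=
  Matrix.fromBlocks
    (Matrix.blockDiagonal' fun i => (((D.sign i : ℤˣ) : ℤ) : ℂ) • sipMatrix (D.size i)) 0 0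
    (Matrix.blockDiagonal' fun j =>
      (sipMatrix (D.csize j + D.csize j)).submatrix finSumFinEquiv finSumFinEquiv)

/-- `D` describes a canonical form of the pair `(B, H)`: for some invertible `S`, the matrices
`S⁻¹ B S` and `S* H S` are the Jordan matrix and the Gram matrix of `D`. The bijection `e` only
numbers the rows and columns by `1, …, n`. -/
def IsCanonicalFormOf (D : CanonicalData) {n : ℕ} (B H : Matrix (Fin n) (Fin n) ℂ) : Prop :=
  ∃ (e : D.Idx ≃ Fin n) (S : Matrix (Fin n) (Fin n) ℂ), IsUnit S ∧
    S⁻¹ * B * S = Matrix.reindex e e D.jordan ∧ Sᴴ * H * S = Matrix.reindex e e D.gram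

/-- `s₊`: the number of Jordan blocks of size one at the eigenvalue zero whose sign is `+1`. -/
noncomputable def sPlus (D : CanonicalData) : ℕ :=
  Set.ncard {i : Fin D.numReal | D.size i = 1 ∧ D.eig i = 0 ∧ D.sign i = 1}

/-- `t`: the number of Jordan blocks of size two at the eigenvalue zero. -/
noncomputable def numSizeTwo (D : CanonicalData) : ℕ :=
  Set.ncard {i : Fin D.numReal | D.size i = 2 ∧ D.eig i = 0}

end CanonicalData

/-!
Since `H B` is positive semidefinite, a canonical form of `(B, H)` can only contain real blocks of
size one and blocks of size two at the eigenvalue zero with sign `+1`; this is read off from the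
diagonal entries of the positive semidefinite matrix `gram * jordan`
(`CanonicalData.size_eq_one_or_size_eq_two`, `CanonicalData.numPairs_eq_zero`). So up to a change of
basis (`PairEquiv`) the pair is a model pair: eigenvectors `u a` with `[u a, u a] = ε a`, and
hyperbolic pairs `w j ↦ v j ↦ 0` with `[v j, w j] = 1` (`modelJordan`, `modelGram`).

Existence of the form (`exists_isCanonicalFamily`). On an invariant nondegenerate subspace, an
eigenvector of nonzero length splits off together with its orthogonal complement. If all
eigenvectors are isotropic, then all eigenvalues vanish, since `[B x, x] = 0` forces `B x = 0`, and
an eigenvector in the image of `B` gives a hyperbolic pair, which splits off likewise.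

Necessity. If `A` is a selfadjoint square root, then `[B A x, A x] = [B x, B x]`, so the form is
nonnegative on the range of `B`, which makes the nonzero eigenvalues positive
(`spectrum_subset_of_exists_sqrt`). Moreover `A (w j)` lies in the kernel of `B`, because
`[B A w, A w] = [B w, B w] = 0`, and `[A (w i), A (w j)] = [v i, w j]`. The kernel of `B` therefore
contains a positive definite subspace with one dimension for each hyperbolic pair, and such a subspace injects into the span of
the `u a` with `μ a = 0` and `ε a = 1` (`card_le_of_exists_sqrt`).

Sufficiency. Each pair `w ↦ v ↦ 0` is joined with its own positive kernel vector `u` to a chain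
`w ↦ u ↦ v ↦ 0`, which squares to `w ↦ v`, `u ↦ 0`; on the other eigenvectors the nonnegative
square root of the eigenvalue is used (`exists_sqrt_of_embedding`).
-/

/-! ### Canonical families of nonnegative operators -/

open ComplexConjugate in
/-- A Hermitian form that vanishes on the diagonal of a subspace vanishes on that subspace. -/
theorem hermitianForm_eq_zero_of_isotropic {V : Type*} [AddCommGroup V] [Module ℂ V]
    (h : V →ₗ⋆[ℂ] V →ₗ[ℂ] ℂ) (W : Submodule ℂ V) (hW : ∀ x ∈ W, h x x = 0)
    {x y : V} (hx : x ∈ W) (hy : y ∈ W) : h x y = 0 := by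
  have h1 := hW _ (W.add_mem hx hy)
  have h2 := hW _ (W.add_mem hx (W.smul_mem Complex.I hy))
  simp only [map_add, LinearMap.add_apply, hW x hx, hW y hy, map_smul, LinearMap.smul_apply,
    LinearMap.map_smulₛₗ, Complex.conj_I, smul_eq_mul] at h1 h2
  have h3 : Complex.I * (h x y - h y x) = 0 := by linear_combination h2
  have h4 : h x y - h y x = 0 := (mul_eq_zero.mp h3).resolve_left Complex.I_ne_zero
  linear_combination (h1 + h4) / 2

/-- A canonical family of an operator `T` that is nonnegative for the Hermitian form `h`:
eigenvectors `u a` with `h (u a) (u a) = ε a = ±1`, and hyperbolic pairs `v j = T (w j)`,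
`T (v j) = 0`, all pairwise orthogonal apart from `h (v j) (w j) = 1`. -/
structure IsCanonicalFamily {V : Type*} [AddCommGroup V] [Module ℂ V]
    (h : V →ₗ⋆[ℂ] V →ₗ[ℂ] ℂ) (T : V →ₗ[ℂ] V) {α τ : Type*} (μ : α → ℝ) (ε : α → ℤˣ)
    (u : α → V) (v w : τ → V) : Prop where
  map_u : ∀ a, T (u a) = (μ a : ℂ) • u a
  map_v : ∀ j, T (v j) = 0
  map_w : ∀ j, T (w j) = v j
  uu_self : ∀ a, h (u a) (u a) = ((ε a : ℤ) : ℂ)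
  uu : ∀ a b, a ≠ b → h (u a) (u b) = 0
  uv : ∀ a j, h (u a) (v j) = 0
  uw : ∀ a j, h (u a) (w j) = 0
  vv : ∀ i j, h (v i) (v j) = 0
  vw_self : ∀ j, h (v j) (w j) = 1
  vw : ∀ i j, i ≠ j → h (v i) (w j) = 0
  ww : ∀ i j, h (w i) (w j) = 0

open ComplexConjugate in
/-- A vector on which a Hermitian form does not vanish has a multiple of length `±1`. -/
theorem exists_smul_eq_sign {V : Type*} [AddCommGroup V] [Module ℂ V]
    (h : V →ₗ⋆[ℂ] V →ₗ[ℂ] ℂ) (hsymm : ∀ x y, conj (h x y) = h y x) {x : V} (hx : h x x ≠ 0) :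
    ∃ (s : ℂ) (ε : ℤˣ), h (s • x) (s • x) = ((ε : ℤ) : ℂ) := by
  obtain ⟨r, hr⟩ := Complex.conj_eq_iff_real.mp (hsymm x x)
  have hr0 : r ≠ 0 := by rintro rfl; exact hx (by simpa using hr)
  have key : (√|r|)⁻¹ * ((√|r|)⁻¹ * r) = r / |r| := by
    rw [← mul_assoc, ← mul_inv, Real.mul_self_sqrt (abs_nonneg r)]; field_simp
  have hform : h (((√|r|)⁻¹ : ℝ) • x) (((√|r|)⁻¹ : ℝ) • x) = ((r / |r| : ℝ) : ℂ) := by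
    rw [← key, ← Complex.coe_smul, map_smul, LinearMap.map_smulₛₗ, LinearMap.smul_apply, hr]
    simp
  refine ⟨(((√|r|)⁻¹ : ℝ) : ℂ), if 0 < r then 1 else -1, ?_⟩
  rw [Complex.coe_smul, hform]
  split_ifs with hp
  · rw [abs_of_pos hp, div_self hr0]; simp
  · rw [abs_of_neg (lt_of_le_of_ne (not_lt.mp hp) hr0), div_neg, div_self hr0]; simp

open ComplexConjugate in
/-- If no eigenvector in `W` has nonzero length, then `W` contains a hyperbolic pair `v = T w`,
`T v = 0`. An eigenvector in the image of `W` lies in the kernel, which gives a first such pair;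
it is then normalised. -/
theorem exists_hyperbolic_pair {V : Type*} [AddCommGroup V] [Module ℂ V] [FiniteDimensional ℂ V]
    (h : V →ₗ⋆[ℂ] V →ₗ[ℂ] ℂ) (T : V →ₗ[ℂ] V) (hsymm : ∀ x y, conj (h x y) = h y x)
    (hpos : ∀ x, 0 ≤ h x (T x)) (hker : ∀ x, h x (T x) = 0 → T x = 0)
    (W : Submodule ℂ V) (hW : ∀ x ∈ W, T x ∈ W)
    (hnd : ∀ x ∈ W, (∀ y ∈ W, h y x = 0) → x = 0) (hne : W ≠ ⊥)
    (hiso : ∀ x ∈ W, ∀ c : ℂ, T x = c • x → h x x = 0) :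
    ∃ v ∈ W, ∃ w ∈ W, T v = 0 ∧ T w = v ∧ h v v = 0 ∧ h v w = 1 ∧ h w w = 0 := by
  have hU : W.map T ≠ ⊥ := by
    intro h0
    have hT : ∀ x ∈ W, T x = 0 := fun x hx => by
      have : T x ∈ W.map T := Submodule.mem_map_of_mem hx
      rwa [h0, Submodule.mem_bot] at this
    apply hne
    rw [Submodule.eq_bot_iff]
    exact fun x hx => hnd x hx fun y hy => hermitianForm_eq_zero_of_isotropic h W
      (fun z hz => hiso z hz 0 (by simp [hT z hz])) hy hx
  have hUinv : ∀ x ∈ W.map T, T x ∈ W.map T := by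
    rintro _ ⟨x, hx, rfl⟩
    exact Submodule.mem_map_of_mem (hW x hx)
  have : Nontrivial (W.map T) := (Submodule.nontrivial_iff_ne_bot).mpr hU
  obtain ⟨c, hc⟩ := Module.End.exists_eigenvalue (T.restrict hUinv)
  obtain ⟨⟨v, hvU⟩, hv⟩ := hc.exists_hasEigenvector
  have hv0 : v ≠ 0 := fun h0 => hv.2 (by simp [h0])
  have hTv : T v = c • v := by simpa using congrArg Subtype.val hv.apply_eq_smul
  obtain ⟨w, hw, rfl⟩ := hvU
  have hvv : h (T w) (T w) = 0 := hiso _ (hW w hw) c hTv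
  have hTTw : T (T w) = 0 := hker _ (by rw [hTv, map_smul, hvv, smul_zero])
  obtain ⟨r, hr⟩ := Complex.conj_eq_iff_real.mp
    (Complex.conj_eq_iff_im.mpr ((Complex.nonneg_iff.mp (hpos w)).2.symm))
  have hr0 : 0 < r := by
    have h1 : (0 : ℂ) ≤ (r : ℂ) := hr ▸ hpos w
    refine lt_of_le_of_ne (by exact_mod_cast h1) ?_
    rintro rfl
    exact hv0 (hker w (by simpa using hr))
  have hr' : h (T w) w = (r : ℂ) := by rw [← hsymm, hr, Complex.conj_ofReal]
  obtain ⟨q, hq⟩ := Complex.conj_eq_iff_real.mp (hsymm w w)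
  have hs : ((√r : ℝ) : ℂ) * (√r : ℝ) = r := by
    rw [← Complex.ofReal_mul, Real.mul_self_sqrt hr0.le]
  have hs0 : ((√r : ℝ) : ℂ) ≠ 0 := by
    exact_mod_cast (Real.sqrt_pos.mpr hr0).ne'
  have hrc : (r : ℂ) ≠ 0 := by exact_mod_cast hr0.ne'
  -- The multiple of `T w` that is subtracted makes the second vector isotropic.
  refine ⟨((√r : ℝ) : ℂ)⁻¹ • T w, W.smul_mem _ (hW w hw),
    ((√r : ℝ) : ℂ)⁻¹ • (w - ((q : ℂ) / (2 * r)) • T w),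
    W.smul_mem _ (W.sub_mem hw (W.smul_mem _ (hW w hw))), ?_, ?_, ?_, ?_, ?_⟩
  · simp [hTTw]
  · simp [hTTw]
  · simp [hvv]
  · simp only [LinearMap.map_smulₛₗ, map_sub, map_smul, LinearMap.smul_apply, hvv, hr',
      smul_eq_mul, map_inv₀, Complex.conj_ofReal, mul_zero, sub_zero]
    rw [← mul_assoc, ← mul_inv, hs, inv_mul_cancel₀ hrc]
  · simp only [LinearMap.map_smulₛₗ, map_sub, map_smul, LinearMap.smul_apply, LinearMap.sub_apply,
      hvv, hr', hr, hq, smul_eq_mul, map_inv₀, map_div₀, map_mul, Complex.conj_ofReal,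
      Complex.conj_ofNat]
    field_simp
    ring

open ComplexConjugate in
/-- Every `T`-invariant subspace on which `h` is nondegenerate is spanned by a canonical family:
split off an eigenvector of nonzero length or a hyperbolic pair, and pass to its orthogonal
complement. -/
theorem exists_isCanonicalFamily {V : Type*} [AddCommGroup V] [Module ℂ V] [FiniteDimensional ℂ V]
    (h : V →ₗ⋆[ℂ] V →ₗ[ℂ] ℂ) (T : V →ₗ[ℂ] V) (hsymm : ∀ x y, conj (h x y) = h y x)
    (hT : ∀ x y, h (T x) y = h x (T y))
    (hpos : ∀ x, 0 ≤ h x (T x)) (hker : ∀ x, h x (T x) = 0 → T x = 0)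
    (W : Submodule ℂ V) : (∀ x ∈ W, T x ∈ W) → (∀ x ∈ W, (∀ y ∈ W, h y x = 0) → x = 0) →
    ∃ (α τ : Type) (_ : Fintype α) (_ : Fintype τ) (μ : α → ℝ) (ε : α → ℤˣ)
      (u : α → V) (v w : τ → V), IsCanonicalFamily h T μ ε u v w ∧
      (∀ a, u a ∈ W) ∧ (∀ j, v j ∈ W) ∧ (∀ j, w j ∈ W) ∧
      W ≤ Submodule.span ℂ (Set.range u ∪ (Set.range v ∪ Set.range w)) := by
  have hswap : ∀ x y, h x y = 0 → h y x = 0 := fun x y hxy => by rw [← hsymm, hxy, map_zero]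
  induction W using IsArtinian.induction with
  | hgt W ih =>
  intro hW hnd
  by_cases hbot : W = ⊥
  · subst hbot
    exact ⟨Empty, Empty, inferInstance, inferInstance, Empty.elim, Empty.elim, Empty.elim,
      Empty.elim, Empty.elim, by constructor <;> rintro ⟨⟩, by rintro ⟨⟩, by rintro ⟨⟩,
      by rintro ⟨⟩, bot_le⟩
  by_cases hiso : ∀ x ∈ W, ∀ c : ℂ, T x = c • x → h x x = 0
  · obtain ⟨v₀, hv₀, w₀, hw₀, hTv, hTw, hvv, hvw, hww⟩ :=
      exists_hyperbolic_pair h T hsymm hpos hker W hW hnd hbot hiso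
    have hwv : h w₀ v₀ = 1 := by rw [← hsymm, hvw, map_one]
    have hmem : ∀ {x}, x ∈ W ⊓ (LinearMap.ker (h v₀) ⊓ LinearMap.ker (h w₀)) ↔
        x ∈ W ∧ h v₀ x = 0 ∧ h w₀ x = 0 := by
      simp
    have hdec : ∀ x ∈ W, x - h w₀ x • v₀ - h v₀ x • w₀ ∈
        W ⊓ (LinearMap.ker (h v₀) ⊓ LinearMap.ker (h w₀)) := fun x hx =>
      hmem.mpr ⟨W.sub_mem (W.sub_mem hx (W.smul_mem _ hv₀)) (W.smul_mem _ hw₀),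
        by simp [hvv, hvw], by simp [hww, hwv]⟩
    obtain ⟨α, τ, _, _, μ, ε, u, v, w, hF, hu, hv, hw, hspan⟩ :=
      ih (W ⊓ (LinearMap.ker (h v₀) ⊓ LinearMap.ker (h w₀)))
        (lt_of_le_of_ne inf_le_left fun he => by
          have := (hmem.mp (he ▸ hv₀)).2.2
          exact one_ne_zero (hwv ▸ this))
        (fun x hx => by
          obtain ⟨h1, h2, h3⟩ := hmem.mp hx
          exact hmem.mpr ⟨hW x h1, by rw [← hT, hTv]; simp, by rw [← hT, hTw, h2]⟩)
        (fun x hx hx0 => by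
          obtain ⟨h1, h2, h3⟩ := hmem.mp hx
          refine hnd x h1 fun y hy => ?_
          have := hx0 _ (hdec y hy)
          simpa [h2, h3] using this)
    have hu' := fun a => hmem.mp (hu a)
    have hv' := fun a => hmem.mp (hv a)
    have hw' := fun a => hmem.mp (hw a)
    refine ⟨α, Option τ, inferInstance, inferInstance, μ, ε, u, fun j => j.elim v₀ v,
      fun j => j.elim w₀ w, ?_, fun a => (hu' a).1, ?_, ?_, ?_⟩
    · constructor
      · exact hF.map_u
      · rintro (_ | j)
        · exact hTv
        · exact hF.map_v j
      · rintro (_ | j)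
        · exact hTw
        · exact hF.map_w j
      · exact hF.uu_self
      · exact hF.uu
      · rintro a (_ | j)
        · exact hswap _ _ (hu' a).2.1
        · exact hF.uv a j
      · rintro a (_ | j)
        · exact hswap _ _ (hu' a).2.2
        · exact hF.uw a j
      · rintro (_ | i) (_ | j)
        · exact hvv
        · exact (hv' j).2.1
        · exact hswap _ _ (hv' i).2.1
        · exact hF.vv i j
      · rintro (_ | j)
        · exact hvw
        · exact hF.vw_self j
      · rintro (_ | i) (_ | j) hij
        · exact absurd rfl hij
        · exact (hw' j).2.1
        · exact hswap _ _ (hv' i).2.2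
        · exact hF.vw i j fun he => hij (he ▸ rfl)
      · rintro (_ | i) (_ | j)
        · exact hww
        · exact (hw' j).2.2
        · exact hswap _ _ (hw' i).2.2
        · exact hF.ww i j
    · rintro (_ | j)
      · exact hv₀
      · exact (hv' j).1
    · rintro (_ | j)
      · exact hw₀
      · exact (hw' j).1
    · intro x hx
      have h1 : x = (x - h w₀ x • v₀ - h v₀ x • w₀) + (h w₀ x • v₀ + h v₀ x • w₀) := by abel
      rw [h1]
      refine Submodule.add_mem _ (Submodule.span_mono ?_ (hspan (hdec x hx)))
        (Submodule.add_mem _ (Submodule.smul_mem _ _ (Submodule.subset_span ?_))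
          (Submodule.smul_mem _ _ (Submodule.subset_span ?_)))
      · refine Set.union_subset_union_right _ (Set.union_subset_union ?_ ?_)
        · rintro _ ⟨j, rfl⟩; exact ⟨some j, rfl⟩
        · rintro _ ⟨j, rfl⟩; exact ⟨some j, rfl⟩
      · exact Or.inr (Or.inl ⟨none, rfl⟩)
      · exact Or.inr (Or.inr ⟨none, rfl⟩)
  · push Not at hiso
    obtain ⟨x₀, hx₀, c, hc, hne⟩ := hiso
    obtain ⟨s, ε₀, hs⟩ := exists_smul_eq_sign h hsymm hne
    obtain ⟨u₀, hu₀_def⟩ : ∃ u₀, u₀ = s • x₀ := ⟨_, rfl⟩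
    rw [← hu₀_def] at hs
    have hu₀ : u₀ ∈ W := hu₀_def ▸ W.smul_mem _ hx₀
    have hTu : T u₀ = c • u₀ := by rw [hu₀_def, map_smul, hc, smul_comm]
    have hε0 : ((ε₀ : ℤ) : ℂ) * ((ε₀ : ℤ) : ℂ) = 1 := by
      rcases Int.units_eq_one_or ε₀ with rfl | rfl <;> simp
    have hcim : c.im = 0 := by
      have h1 := (Complex.nonneg_iff.mp (hpos u₀)).2
      rw [hTu, map_smul, hs, smul_eq_mul] at h1
      rcases Int.units_eq_one_or ε₀ with rfl | rfl <;> simpa using h1.symm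
    have hmem : ∀ {x}, x ∈ W ⊓ LinearMap.ker (h u₀) ↔ x ∈ W ∧ h u₀ x = 0 := by
      simp
    have hdec : ∀ x ∈ W, x - (((ε₀ : ℤ) : ℂ) * h u₀ x) • u₀ ∈ W ⊓ LinearMap.ker (h u₀) :=
      fun x hx => hmem.mpr ⟨W.sub_mem hx (W.smul_mem _ hu₀), by
        rw [map_sub, map_smul, hs, smul_eq_mul]
        linear_combination (- h u₀ x) * hε0⟩
    obtain ⟨α, τ, _, _, μ, ε, u, v, w, hF, hu, hv, hw, hspan⟩ :=
      ih (W ⊓ LinearMap.ker (h u₀))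
        (lt_of_le_of_ne inf_le_left fun he => by
          have := (hmem.mp (he ▸ hu₀)).2
          rw [hs] at this
          simp [this] at hε0)
        (fun x hx => by
          obtain ⟨h1, h2⟩ := hmem.mp hx
          exact hmem.mpr ⟨hW x h1, by rw [← hT, hTu]; simp [h2]⟩)
        (fun x hx hx0 => by
          obtain ⟨h1, h2⟩ := hmem.mp hx
          refine hnd x h1 fun y hy => ?_
          have := hx0 _ (hdec y hy)
          simpa [h2] using this)
    have hu' := fun a => hmem.mp (hu a)
    have hv' := fun a => hmem.mp (hv a)
    have hw' := fun a => hmem.mp (hw a)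
    refine ⟨Option α, τ, inferInstance, inferInstance, fun a => a.elim c.re μ,
      fun a => a.elim ε₀ ε, fun a => a.elim u₀ u, v, w, ?_, ?_, fun a => (hv' a).1,
      fun a => (hw' a).1, ?_⟩
    · constructor
      · rintro (_ | j)
        · have : ((c.re : ℝ) : ℂ) = c := Complex.ext rfl (by simp [hcim])
          simpa [this] using hTu
        · exact hF.map_u j
      · exact hF.map_v
      · exact hF.map_w
      · rintro (_ | j)
        · exact hs
        · exact hF.uu_self j
      · rintro (_ | i) (_ | j) hij
        · exact absurd rfl hij
        · exact (hu' j).2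
        · exact hswap _ _ (hu' i).2
        · exact hF.uu i j fun he => hij (he ▸ rfl)
      · rintro (_ | i) j
        · exact (hv' j).2
        · exact hF.uv i j
      · rintro (_ | i) j
        · exact (hw' j).2
        · exact hF.uw i j
      · exact hF.vv
      · exact hF.vw_self
      · exact hF.vw
      · exact hF.ww
    · rintro (_ | j)
      · exact hu₀
      · exact (hu' j).1
    · intro x hx
      have h1 : x = (x - (((ε₀ : ℤ) : ℂ) * h u₀ x) • u₀) + (((ε₀ : ℤ) : ℂ) * h u₀ x) • u₀ := by
        abel
      rw [h1]
      refine Submodule.add_mem _ (Submodule.span_mono ?_ (hspan (hdec x hx)))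
        (Submodule.smul_mem _ _ (Submodule.subset_span ?_))
      · refine Set.union_subset_union_left _ ?_
        rintro _ ⟨j, rfl⟩; exact ⟨some j, rfl⟩
      · exact Or.inl ⟨none, rfl⟩

/-! ### Change of basis and the model pair -/

/-- The pairs `(B, H)` and `(J, G)` are the same operator and form in two bases: `M` is the change
of basis and `N` its inverse. The two index types need not agree. -/
def PairEquiv {κ ι : Type*} [Fintype κ] [Fintype ι] [DecidableEq κ] [DecidableEq ι]
    (B H : Matrix κ κ ℂ) (J G : Matrix ι ι ℂ) : Prop :=
  ∃ (M : Matrix κ ι ℂ) (N : Matrix ι κ ℂ),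
    M * N = 1 ∧ N * M = 1 ∧ N * B * M = J ∧ Mᴴ * H * M = G

namespace PairEquiv

variable {κ ι ι' : Type*} [Fintype κ] [Fintype ι] [Fintype ι'] [DecidableEq κ] [DecidableEq ι]
  [DecidableEq ι'] {B H : Matrix κ κ ℂ} {J G : Matrix ι ι ℂ}

theorem symm (h : PairEquiv B H J G) : PairEquiv J G B H := by
  obtain ⟨M, N, hMN, hNM, rfl, rfl⟩ := h
  refine ⟨N, M, hNM, hMN, ?_, ?_⟩
  · calc M * (N * B * M) * N = (M * N) * B * (M * N) := by simp only [Matrix.mul_assoc]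
      _ = B := by simp [hMN]
  · calc Nᴴ * (Mᴴ * H * M) * N = (M * N)ᴴ * H * (M * N) := by
          simp only [Matrix.mul_assoc, conjTranspose_mul]
      _ = H := by simp [hMN]

theorem reindex (h : PairEquiv B H J G) (g : ι' ≃ ι) :
    PairEquiv B H (J.submatrix g g) (G.submatrix g g) := by
  obtain ⟨M, N, hMN, hNM, rfl, rfl⟩ := h
  refine ⟨M.submatrix id g, N.submatrix g id, ?_, ?_, ?_, ?_⟩
  · rw [submatrix_mul_equiv, hMN, submatrix_id_id]
  · rw [← submatrix_mul _ _ _ _ _ Function.bijective_id, hNM, submatrix_one_equiv]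
  · rw [submatrix_mul _ _ g id g Function.bijective_id,
      submatrix_mul _ _ g id id Function.bijective_id, submatrix_id_id]
  · rw [conjTranspose_submatrix, submatrix_mul _ _ g id g Function.bijective_id,
      submatrix_mul _ _ g id id Function.bijective_id, submatrix_id_id]

/-- A selfadjoint square root is carried along a change of basis. -/
theorem exists_sqrt (h : PairEquiv B H J G) (hA : ∃ A, H * A = Aᴴ * H ∧ A * A = B) :
    ∃ A, G * A = Aᴴ * G ∧ A * A = J := by
  obtain ⟨A, hA, rfl⟩ := hA
  obtain ⟨M, N, hMN, hNM, rfl, rfl⟩ := h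
  refine ⟨N * A * M, ?_, ?_⟩
  · calc Mᴴ * H * M * (N * A * M) = Mᴴ * H * (M * N) * A * M := by simp only [Matrix.mul_assoc]
      _ = Mᴴ * (H * A) * M := by rw [hMN, Matrix.mul_one, ← Matrix.mul_assoc]
      _ = Mᴴ * Aᴴ * (M * N)ᴴ * H * M := by
          rw [hA, hMN, conjTranspose_one, Matrix.mul_one, ← Matrix.mul_assoc]
      _ = (N * A * M)ᴴ * (Mᴴ * H * M) := by simp only [Matrix.mul_assoc, conjTranspose_mul]
  · calc N * A * M * (N * A * M) = N * A * (M * N) * A * M := by simp only [Matrix.mul_assoc]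
      _ = N * (A * A) * M := by rw [hMN, Matrix.mul_one, ← Matrix.mul_assoc]

theorem posSemidef (h : PairEquiv B H J G) (hP : (H * B).PosSemidef) : (G * J).PosSemidef := by
  obtain ⟨M, N, hMN, hNM, rfl, rfl⟩ := h
  have : Mᴴ * H * M * (N * B * M) = Mᴴ * (H * B) * M := by
    calc Mᴴ * H * M * (N * B * M) = Mᴴ * H * (M * N) * B * M := by simp only [Matrix.mul_assoc]
      _ = Mᴴ * (H * B) * M := by rw [hMN, Matrix.mul_one, Matrix.mul_assoc Mᴴ H B]
  rw [this]
  exact hP.conjTranspose_mul_mul_same M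

theorem mulVec_eigenvector (h : PairEquiv B H J G) {z : ℂ} {x : ι → ℂ} (hx : x ≠ 0)
    (hJ : J *ᵥ x = z • x) : ∃ y, y ≠ 0 ∧ B *ᵥ y = z • y := by
  obtain ⟨M, N, hMN, hNM, rfl, rfl⟩ := h
  refine ⟨M *ᵥ x, fun h0 => hx ?_, ?_⟩
  · rw [← Matrix.one_mulVec x, ← hNM, ← Matrix.mulVec_mulVec, h0, Matrix.mulVec_zero]
  · rw [← Matrix.mulVec_smul, ← hJ, Matrix.mulVec_mulVec, Matrix.mulVec_mulVec,
      ← Matrix.mul_assoc, ← Matrix.mul_assoc, hMN, Matrix.one_mul]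

end PairEquiv

theorem CanonicalData.isCanonicalFormOf_iff_pairEquiv (D : CanonicalData) {n : ℕ}
    (B H : Matrix (Fin n) (Fin n) ℂ) :
    D.IsCanonicalFormOf B H ↔ PairEquiv B H D.jordan D.gram := by
  constructor
  · rintro ⟨e, S, hS, hJ, hG⟩
    have hdet := (Matrix.isUnit_iff_isUnit_det S).mp hS
    have h : PairEquiv B H (Matrix.reindex e e D.jordan) (Matrix.reindex e e D.gram) :=
      ⟨S, S⁻¹, Matrix.mul_nonsing_inv S hdet, Matrix.nonsing_inv_mul S hdet, hJ, hG⟩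
    simpa [Matrix.reindex_apply] using h.reindex e
  · intro h
    have hcard : Fintype.card D.Idx = Fintype.card (Fin n) := by
      obtain ⟨M, N, hMN, hNM, -, -⟩ := h
      exact Matrix.square_of_invertible _ _ hNM hMN
    let e : D.Idx ≃ Fin n := Fintype.equivOfCardEq hcard
    obtain ⟨S, T, hST, hTS, hJ, hG⟩ := h.reindex e.symm
    refine ⟨e, S, IsUnit.of_mul_eq_one T hST, ?_, hG⟩
    rw [Matrix.inv_eq_right_inv hST]
    exact hJ

/-- The operator with eigenvectors of eigenvalues `μ a` and with nilpotent blocks of size two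
indexed by `τ`. The first copy of `τ` indexes the kernel vectors, the second copy their
preimages. -/
def modelJordan {α : Type*} [DecidableEq α] (μ : α → ℝ) (τ : Type*) [DecidableEq τ] :
    Matrix (α ⊕ (τ ⊕ τ)) (α ⊕ (τ ⊕ τ)) ℂ :=
  fromBlocks (diagonal fun a => (μ a : ℂ)) 0 0 (fromBlocks 0 1 0 0)

/-- The Gram matrix belonging to `modelJordan`: signs `ε a` on the eigenvectors, hyperbolic planes
on the nilpotent blocks. -/
def modelGram {α : Type*} [DecidableEq α] (ε : α → ℤˣ) (τ : Type*) [DecidableEq τ] :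
    Matrix (α ⊕ (τ ⊕ τ)) (α ⊕ (τ ⊕ τ)) ℂ :=
  fromBlocks (diagonal fun a => ((ε a : ℤ) : ℂ)) 0 0 (fromBlocks 0 1 1 0)

theorem modelGram_mul_self {α τ : Type*} [Fintype α] [Fintype τ] [DecidableEq α] [DecidableEq τ]
    (ε : α → ℤˣ) : modelGram ε τ * modelGram ε τ = 1 := by
  have h : ∀ a, ((ε a : ℤ) : ℂ) * ((ε a : ℤ) : ℂ) = 1 := fun a => by
    rcases Int.units_eq_one_or (ε a) with h | h <;> simp [h]
  simp [modelGram, fromBlocks_multiply, h, fromBlocks_one]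

theorem isHNonneg_iff {n : ℕ} (H B : Matrix (Fin n) (Fin n) ℂ) :
    IsHNonneg H B ↔ ∀ x, 0 ≤ star x ⬝ᵥ ((H * B) *ᵥ x) := by
  simp only [IsHNonneg, indefInner, Matrix.mulVec_mulVec, dotProduct_comm]

/-- Over the complex numbers a nonnegative quadratic form is automatically Hermitian. -/
theorem IsHNonneg.posSemidef {n : ℕ} {H B : Matrix (Fin n) (Fin n) ℂ} (hB : IsHNonneg H B) :
    (H * B).PosSemidef := by
  rw [isHNonneg_iff] at hB
  rw [← Matrix.isPositive_toEuclideanLin_iff, LinearMap.isPositive_iff_complex]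
  intro x
  have h : inner ℂ ((H * B).toEuclideanLin x) x = star (star x.ofLp ⬝ᵥ ((H * B) *ᵥ x.ofLp)) := by
    rw [EuclideanSpace.inner_eq_star_dotProduct, Matrix.toLpLin_apply, ← Matrix.star_dotProduct_star,
      star_star, dotProduct_comm]
  rw [h]
  have h2 := Complex.nonneg_iff.mp (star_nonneg_iff.mpr (hB x.ofLp))
  exact ⟨Complex.ext rfl h2.2, h2.1⟩

/-- The matrix of a spanning canonical family is a change of basis to the model pair. -/
theorem exists_pairEquiv_model {n : ℕ} {H B : Matrix (Fin n) (Fin n) ℂ}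
    (hH : H.IsHermitian) (hHinv : IsUnit H) (hP : (H * B).PosSemidef) :
    ∃ (α τ : Type) (_ : Fintype α) (_ : Fintype τ) (_ : DecidableEq α) (_ : DecidableEq τ)
      (μ : α → ℝ) (ε : α → ℤˣ), PairEquiv B H (modelJordan μ τ) (modelGram ε τ) := by
  classical
  have hHinj : ∀ x, H *ᵥ x = 0 → x = 0 := fun x hx =>
    Matrix.mulVec_injective_of_isUnit hHinv (by simpa using hx)
  let h : (Fin n → ℂ) →ₗ⋆[ℂ] (Fin n → ℂ) →ₗ[ℂ] ℂ :=
    LinearMap.mk₂'ₛₗ (starRingEnd ℂ) (RingHom.id ℂ) (fun x y => star x ⬝ᵥ (H *ᵥ y))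
      (by intros; simp [add_dotProduct]) (by intros; simp)
      (by intros; simp [mulVec_add]) (by intros; simp [mulVec_smul])
  have happ : ∀ x y, h x y = star x ⬝ᵥ (H *ᵥ y) := fun _ _ => rfl
  have hsymm : ∀ x y, starRingEnd ℂ (h x y) = h y x := fun x y => by
    rw [happ, happ, starRingEnd_apply, Matrix.star_dotProduct, star_star, Matrix.star_mulVec,
      hH.eq, Matrix.dotProduct_mulVec]
  have hBH : Bᴴ * H = H * B := by
    have := hP.isHermitian
    rwa [Matrix.IsHermitian, conjTranspose_mul, hH.eq] at this
  obtain ⟨α, τ, _, _, μ, ε, u, v, w, hF, -, -, -, hspan⟩ :=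
    exists_isCanonicalFamily h (Matrix.toLin' B)
      hsymm
      (fun x y => by
        rw [happ, happ, toLin'_apply, toLin'_apply, star_mulVec, ← dotProduct_mulVec,
          mulVec_mulVec, mulVec_mulVec, hBH])
      (fun x => by
        rw [happ, toLin'_apply, mulVec_mulVec]; exact hP.dotProduct_mulVec_nonneg x)
      (fun x hx => by
        rw [happ, toLin'_apply, mulVec_mulVec, hP.dotProduct_mulVec_zero_iff,
          ← mulVec_mulVec] at hx
        exact hHinj _ hx)
      ⊤ (fun _ _ => trivial)
      (fun x _ hx => hHinj x (by
        ext i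
        have := hx (Pi.single i 1) trivial
        simpa [happ, ← Pi.single_star] using this))
  refine ⟨α, τ, inferInstance, inferInstance, inferInstance, inferInstance, μ, ε, ?_⟩
  let c : α ⊕ (τ ⊕ τ) → (Fin n → ℂ) := Sum.elim u (Sum.elim v w)
  let M : Matrix (Fin n) (α ⊕ (τ ⊕ τ)) ℂ := Matrix.of fun i p => c p i
  have hG : Mᴴ * H * M = modelGram ε τ := by
    have hent : ∀ p q, (Mᴴ * H * M) p q = h (c p) (c q) := fun p q => by
      rw [Matrix.mul_assoc, Matrix.mul_apply]; rfl
    ext p q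
    rw [hent]
    rcases p with a | i | i <;> rcases q with b | j | j
    · by_cases hab : a = b
      · subst hab; simpa [modelGram, c] using hF.uu_self a
      · simpa [modelGram, c, hab] using hF.uu a b hab
    · simpa [modelGram, c] using hF.uv a j
    · simpa [modelGram, c] using hF.uw a j
    · rw [← hsymm]; simpa [modelGram, c] using hF.uv b i
    · simpa [modelGram, c] using hF.vv i j
    · by_cases hij : i = j
      · subst hij; simpa [modelGram, c] using hF.vw_self i
      · simpa [modelGram, c, hij] using hF.vw i j hij
    · rw [← hsymm]; simpa [modelGram, c] using hF.uw b i
    · rw [← hsymm]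
      by_cases hij : i = j
      · subst hij; simp [modelGram, c, hF.vw_self]
      · simp [modelGram, c, hij, hF.vw j i (Ne.symm hij)]
    · simpa [modelGram, c] using hF.ww i j
  have hJ : B * M = M * modelJordan μ τ := by
    have hent : ∀ i p, (B * M) i p = Matrix.toLin' B (c p) i := fun i p => by
      rw [Matrix.mul_apply]; rfl
    ext i p
    rw [hent]
    rcases p with a | j | j
    · simp only [c, Sum.elim_inl, hF.map_u]
      simp [Matrix.mul_apply, modelJordan, M, c, diagonal_apply, mul_comm]
    · simp only [c, Sum.elim_inl, Sum.elim_inr, hF.map_v]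
      simp [Matrix.mul_apply, modelJordan, M, c]
    · simp only [c, Sum.elim_inr, hF.map_w]
      simp [Matrix.mul_apply, modelJordan, M, c, Matrix.one_apply]
  -- The Gram matrix is its own inverse, which provides a left inverse of `M`.
  have hNM : (modelGram ε τ * Mᴴ * H) * M = 1 := by
    rw [Matrix.mul_assoc, Matrix.mul_assoc, ← Matrix.mul_assoc Mᴴ, hG, modelGram_mul_self]
  have hsurj : ∀ x, ∃ y, M *ᵥ y = x := by
    intro x
    have hx : x ∈ LinearMap.range M.mulVecLin := by
      rw [Matrix.range_mulVecLin]
      refine Submodule.span_mono ?_ (hspan (Submodule.mem_top (x := x)))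
      rintro _ (⟨a, rfl⟩ | ⟨j, rfl⟩ | ⟨j, rfl⟩)
      · exact ⟨Sum.inl a, rfl⟩
      · exact ⟨Sum.inr (Sum.inl j), rfl⟩
      · exact ⟨Sum.inr (Sum.inr j), rfl⟩
    exact hx
  have hMN : M * (modelGram ε τ * Mᴴ * H) = 1 := by
    refine Matrix.ext_of_mulVec_single fun i => ?_
    obtain ⟨y, hy⟩ := hsurj (Pi.single i 1)
    rw [← hy, mulVec_mulVec, Matrix.mul_assoc, hNM, Matrix.mul_one, one_mulVec]
  refine ⟨M, _, hMN, hNM, ?_, hG⟩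
  rw [Matrix.mul_assoc, hJ, ← Matrix.mul_assoc, hNM, Matrix.one_mul]

/-! ### Canonical forms of nonnegative pairs -/

namespace CanonicalData

/-- Canonical data whose blocks are of size one (indexed by `α`) or positive nilpotent blocks of
size two (indexed by `τ`) give the model pair, after renumbering the basis. -/
theorem exists_equiv_model (D : CanonicalData) {α τ : Type*} [DecidableEq α] [DecidableEq τ]
    (h : α ⊕ τ ≃ Fin D.numReal) (hpairs : D.numPairs = 0)
    (h1 : ∀ a, D.size (h (Sum.inl a)) = 1) (h2 : ∀ j, D.size (h (Sum.inr j)) = 2)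
    (heig : ∀ j, D.eig (h (Sum.inr j)) = 0) (hsign : ∀ j, D.sign (h (Sum.inr j)) = 1) :
    ∃ g : α ⊕ (τ ⊕ τ) ≃ D.Idx,
      D.jordan.submatrix g g = modelJordan (fun a => D.eig (h (Sum.inl a))) τ ∧
      D.gram.submatrix g g = modelGram (fun a => D.sign (h (Sum.inl a))) τ := by
  let g : α ⊕ (τ ⊕ τ) → D.Idx := Sum.elim
    (fun a => Sum.inl ⟨h (Sum.inl a), ⟨0, by rw [h1]; exact one_pos⟩⟩)
    (Sum.elim (fun j => Sum.inl ⟨h (Sum.inr j), ⟨0, by rw [h2]; exact two_pos⟩⟩)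
      (fun j => Sum.inl ⟨h (Sum.inr j), ⟨1, by rw [h2]; exact one_lt_two⟩⟩))
  have hfst : ∀ {i j : Fin D.numReal} {k : Fin (D.size i)} {l : Fin (D.size j)},
      (Sum.inl ⟨i, k⟩ : D.Idx) = Sum.inl ⟨j, l⟩ → i = j ∧ (k : ℕ) = l := by
    intro i j k l he
    obtain ⟨rfl, he⟩ := Sigma.mk.inj_iff.mp (Sum.inl.inj he)
    exact ⟨rfl, congrArg Fin.val (eq_of_heq he)⟩
  have hinj : Function.Injective g := by
    rintro (a | i | i) (b | j | j) he <;> obtain ⟨he1, he2⟩ := hfst he <;>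
      simp_all
  have hsurj : Function.Surjective g := by
    rintro (⟨i, k⟩ | ⟨j, -⟩)
    · obtain ⟨a | j, rfl⟩ := h.surjective i
      · refine ⟨Sum.inl a, ?_⟩
        have : k = ⟨0, by rw [h1]; exact one_pos⟩ := by
          ext; have := k.2; have := h1 a; simp only; omega
        rw [this]; rfl
      · have hk := k.2
        have := h2 j
        have hk' : (k : ℕ) = 0 ∨ (k : ℕ) = 1 := by omega
        rcases hk' with hk' | hk'
        · refine ⟨Sum.inr (Sum.inl j), ?_⟩
          have : k = ⟨0, by rw [h2]; exact two_pos⟩ := Fin.ext hk'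
          rw [this]; rfl
        · refine ⟨Sum.inr (Sum.inr j), ?_⟩
          have : k = ⟨1, by rw [h2]; exact one_lt_two⟩ := Fin.ext hk'
          rw [this]; rfl
    · exact (Fin.cast hpairs j).elim0
  have hbij : Function.Bijective g := ⟨hinj, hsurj⟩
  refine ⟨Equiv.ofBijective g hbij, ?_, ?_⟩ <;> ext p q <;>
    rw [submatrix_apply, Equiv.ofBijective_apply, Equiv.ofBijective_apply]
  · have hne : ∀ {i j : Fin D.numReal} (k : Fin (D.size i)) (l : Fin (D.size j)), i ≠ j →
        D.jordan (Sum.inl ⟨i, k⟩) (Sum.inl ⟨j, l⟩) = 0 := fun k l hij => by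
      simp [jordan, blockDiagonal'_apply_ne _ _ _ hij]
    have heq : ∀ (i : Fin D.numReal) (k l : Fin (D.size i)),
        D.jordan (Sum.inl ⟨i, k⟩) (Sum.inl ⟨i, l⟩) = jordanBlock (D.size i) (D.eig i : ℂ) k l :=
      fun i k l => by simp [jordan, blockDiagonal'_apply_eq]
    rcases p with a | i | i <;> rcases q with b | j | j
    · by_cases hab : a = b
      · subst hab; simp [g, modelJordan, heq, jordanBlock]
      · simp [g, modelJordan, hne, hab]
    · simp [g, modelJordan, hne]
    · simp [g, modelJordan, hne]
    · simp [g, modelJordan, hne]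
    · by_cases hab : i = j
      · subst hab; simp [g, modelJordan, heq, jordanBlock, heig]
      · simp [g, modelJordan, hne, hab]
    · by_cases hab : i = j
      · subst hab; simp [g, modelJordan, heq, jordanBlock]
      · simp [g, modelJordan, hne, hab]
    · simp [g, modelJordan, hne]
    · by_cases hab : i = j
      · subst hab; simp [g, modelJordan, heq, jordanBlock]
      · simp [g, modelJordan, hne, hab]
    · by_cases hab : i = j
      · subst hab; simp [g, modelJordan, heq, jordanBlock, heig]
      · simp [g, modelJordan, hne, hab]
  · have hne : ∀ {i j : Fin D.numReal} (k : Fin (D.size i)) (l : Fin (D.size j)), i ≠ j →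
        D.gram (Sum.inl ⟨i, k⟩) (Sum.inl ⟨j, l⟩) = 0 := fun k l hij => by
      simp [gram, blockDiagonal'_apply_ne _ _ _ hij]
    have heq : ∀ (i : Fin D.numReal) (k l : Fin (D.size i)),
        D.gram (Sum.inl ⟨i, k⟩) (Sum.inl ⟨i, l⟩) =
          ((D.sign i : ℤ) : ℂ) * sipMatrix (D.size i) k l :=
      fun i k l => by simp [gram, blockDiagonal'_apply_eq]
    rcases p with a | i | i <;> rcases q with b | j | j
    · by_cases hab : a = b
      · subst hab; simp [g, modelGram, heq, sipMatrix, h1]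
      · simp [g, modelGram, hne, hab]
    · simp [g, modelGram, hne]
    · simp [g, modelGram, hne]
    · simp [g, modelGram, hne]
    · by_cases hab : i = j
      · subst hab; simp [g, modelGram, heq, sipMatrix, h2]
      · simp [g, modelGram, hne, hab]
    · by_cases hab : i = j
      · subst hab; simp [g, modelGram, heq, sipMatrix, h2, hsign]
      · simp [g, modelGram, hne, hab]
    · simp [g, modelGram, hne]
    · by_cases hab : i = j
      · subst hab; simp [g, modelGram, heq, sipMatrix, h2, hsign]
      · simp [g, modelGram, hne, hab]
    · by_cases hab : i = j
      · subst hab; simp [g, modelGram, heq, sipMatrix, h2]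
      · simp [g, modelGram, hne, hab]

end CanonicalData

/-- Multiplying by the sip matrix from the left reverses the order of the rows. -/
theorem sipMatrix_mul_apply {k : ℕ} {ι : Type*} (N : Matrix (Fin k) ι ℂ) (i : Fin k) (j : ι) :
    (sipMatrix k * N) i j = N i.rev j := by
  have h : ∀ l : Fin k, ((i : ℕ) + (l : ℕ) + 1 = k) ↔ l = i.rev := fun l => by
    rw [Fin.ext_iff, Fin.val_rev]; omega
  simp [Matrix.mul_apply, sipMatrix, h]

theorem Matrix.PosSemidef.apply_eq_zero_of_diag_eq_zero {ι : Type*} [Fintype ι] [DecidableEq ι]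
    {P : Matrix ι ι ℂ} (hP : P.PosSemidef) {p : ι} (hp : P p p = 0) (q : ι) : P p q = 0 := by
  have h : P *ᵥ Pi.single p 1 = 0 := by
    rw [← hP.dotProduct_mulVec_zero_iff]
    simp [hp]
  have h2 : P q p = 0 := by simpa using congrFun h q
  rw [← hP.isHermitian.apply, h2, star_zero]

namespace CanonicalData

theorem gram_mul_jordan_inl (D : CanonicalData) (i : Fin D.numReal) (k l : Fin (D.size i)) :
    (D.gram * D.jordan) (Sum.inl ⟨i, k⟩) (Sum.inl ⟨i, l⟩) =
      ((D.sign i : ℤ) : ℂ) * jordanBlock (D.size i) (D.eig i : ℂ) k.rev l := by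
  rw [gram, jordan, fromBlocks_multiply]
  simp [← blockDiagonal'_mul, blockDiagonal'_apply_eq, sipMatrix_mul_apply]

/-- In the block of a nonreal pair, the first diagonal entry of `gram * jordan` vanishes, while the
last entry of its row is the conjugate of the nonreal eigenvalue, hence nonzero. -/
theorem numPairs_eq_zero (D : CanonicalData) (hP : (D.gram * D.jordan).PosSemidef) :
    D.numPairs = 0 := by
  by_contra hne
  let j : Fin D.numPairs := ⟨0, Nat.pos_of_ne_zero hne⟩
  let a : Fin (D.csize j) := ⟨0, D.csize_pos j⟩
  have hrev : (finSumFinEquiv (Sum.inl a : Fin (D.csize j) ⊕ Fin (D.csize j))).rev =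
      finSumFinEquiv (Sum.inr a.rev) := by
    ext
    have := D.csize_pos j
    simp [a, Fin.val_rev]
    omega
  have hent : ∀ q, (D.gram * D.jordan) (Sum.inr ⟨j, Sum.inl a⟩) (Sum.inr ⟨j, q⟩) =
      fromBlocks (jordanBlock (D.csize j) (D.ceig j)) 0 0
        (jordanBlock (D.csize j) (star (D.ceig j))) (Sum.inr a.rev) q := by
    intro q
    rw [gram, jordan, fromBlocks_multiply]
    simp only [Matrix.zero_mul, zero_add, fromBlocks_apply₂₂, ← blockDiagonal'_mul,
      blockDiagonal'_apply_eq]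
    obtain ⟨F, hF⟩ : ∃ F, F = fromBlocks (jordanBlock (D.csize j) (D.ceig j)) 0 0
        (jordanBlock (D.csize j) (star (D.ceig j))) := ⟨_, rfl⟩
    have h2 : (sipMatrix (D.csize j + D.csize j)).submatrix finSumFinEquiv finSumFinEquiv * F =
        (sipMatrix (D.csize j + D.csize j) * F.submatrix finSumFinEquiv.symm id).submatrix
          finSumFinEquiv id := by
      rw [submatrix_mul _ _ _ finSumFinEquiv _ finSumFinEquiv.bijective]
      simp
    rw [← hF, h2, submatrix_apply, sipMatrix_mul_apply, hrev, submatrix_apply,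
      Equiv.symm_apply_apply]
    rfl
  have h0 := hP.apply_eq_zero_of_diag_eq_zero (p := Sum.inr ⟨j, Sum.inl a⟩) (by rw [hent]; simp)
    (Sum.inr ⟨j, Sum.inr a.rev⟩)
  rw [hent] at h0
  have h1 : D.ceig j = 0 := by simpa [jordanBlock] using h0
  have := D.ceig_im_pos j
  simp [h1] at this

/-- Nonnegativity of a Jordan block of size at least two: the top left diagonal entry vanishes, so
the eigenvalue in its row does; from size three on the second diagonal entry vanishes too, although
its row holds an off-diagonal one. -/
theorem size_eq_one_or_size_eq_two (D : CanonicalData) (hP : (D.gram * D.jordan).PosSemidef)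
    (i : Fin D.numReal) :
    D.size i = 1 ∨ (D.size i = 2 ∧ D.eig i = 0 ∧ D.sign i = 1) := by
  have hpos := D.size_pos i
  by_cases hsize : D.size i = 1
  · exact Or.inl hsize
  right
  have hent := D.gram_mul_jordan_inl i
  have hs : ((D.sign i : ℤ) : ℂ) ≠ 0 := by
    rcases Int.units_eq_one_or (D.sign i) with h | h <;> simp [h]
  have heig : D.eig i = 0 := by
    have h0 := hP.apply_eq_zero_of_diag_eq_zero (p := Sum.inl ⟨i, ⟨0, hpos⟩⟩)
      (by rw [hent]; simp [jordanBlock, Fin.ext_iff, Fin.val_rev]; omega)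
      (Sum.inl ⟨i, Fin.rev ⟨0, hpos⟩⟩)
    rw [hent] at h0
    simpa [jordanBlock, hs] using h0
  have h2 : D.size i = 2 := by
    by_contra hne
    have hlt : 1 < D.size i := by omega
    have h0 := hP.apply_eq_zero_of_diag_eq_zero (p := Sum.inl ⟨i, ⟨1, hlt⟩⟩)
      (by rw [hent]; simp [jordanBlock, Fin.ext_iff, Fin.val_rev, heig]; omega)
      (Sum.inl ⟨i, ⟨D.size i - 1, by omega⟩⟩)
    rw [hent] at h0
    have h3 : (D.size i - (1 + 1) : ℕ) + 1 = D.size i - 1 := by omega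
    simp [jordanBlock, Fin.ext_iff, Fin.val_rev, heig, hs, h3] at h0
    omega
  refine ⟨h2, heig, ?_⟩
  have hd := hP.diag_nonneg (i := Sum.inl ⟨i, ⟨1, by omega⟩⟩)
  rw [hent] at hd
  rcases Int.units_eq_one_or (D.sign i) with h | h
  · exact h
  · exfalso
    simp [jordanBlock, Fin.ext_iff, Fin.val_rev, heig, h, h2] at hd
    exact absurd hd (by norm_num)

end CanonicalData

/-! ### Square roots of the model operator -/

/-- If the model operator has a square root `A` that is selfadjoint for the model form, then `A`
maps the span of the second vectors of the nilpotent blocks injectively into the kernel of the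
operator, onto a subspace on which the form is positive definite. Hence the nilpotent blocks are at
most as many as the positive eigenvectors of eigenvalue zero. -/
theorem card_le_of_exists_sqrt {α τ : Type*} [Fintype α] [Fintype τ] [DecidableEq α]
    [DecidableEq τ] {μ : α → ℝ} {ε : α → ℤˣ}
    (hP : (modelGram ε τ * modelJordan μ τ).PosSemidef)
    (hA : ∃ A, modelGram ε τ * A = Aᴴ * modelGram ε τ ∧ A * A = modelJordan μ τ) :
    Fintype.card τ ≤ Nat.card {a : α // μ a = 0 ∧ ε a = 1} := by
  classical
  obtain ⟨A, hGA, hAA⟩ := hA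
  set G := modelGram ε τ with hG
  set J := modelJordan μ τ with hJ
  let E : (τ → ℂ) →ₗ[ℂ] (α ⊕ (τ ⊕ τ) → ℂ) :=
    { toFun := fun c => Sum.elim (0 : α → ℂ) (Sum.elim (0 : τ → ℂ) c)
      map_add' := fun c d => by ext (a | i | i) <;> simp
      map_smul' := fun r c => by ext (a | i | i) <;> simp }
  have hE : ∀ c, E c = Sum.elim (0 : α → ℂ) (Sum.elim (0 : τ → ℂ) c) := fun _ => rfl
  have hJE : ∀ c, J *ᵥ E c = Sum.elim (0 : α → ℂ) (Sum.elim c (0 : τ → ℂ)) := fun c => by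
    rw [hJ, modelJordan, hE, fromBlocks_mulVec]
    ext (a | i | i) <;> simp [Function.comp_def, fromBlocks_mulVec, mulVec_diagonal]
  have hJJE : ∀ c, J *ᵥ (J *ᵥ E c) = 0 := fun c => by
    rw [hJE, hJ, modelJordan, fromBlocks_mulVec]
    ext (a | i | i) <;> simp [Function.comp_def, fromBlocks_mulVec, mulVec_diagonal]
  have hmove : ∀ x y : α ⊕ (τ ⊕ τ) → ℂ, star (A *ᵥ x) ⬝ᵥ (G *ᵥ (A *ᵥ y)) =
      star x ⬝ᵥ (G *ᵥ (J *ᵥ y)) := fun x y => by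
    rw [star_mulVec, ← dotProduct_mulVec, mulVec_mulVec, ← hGA, ← mulVec_mulVec, mulVec_mulVec y A,
      hAA]
  -- As `[B A w, A w] = [B w, B w] = 0`, semidefiniteness gives `B A w = 0`.
  have hker : ∀ c, J *ᵥ (A *ᵥ E c) = 0 := fun c => by
    have h1 : (G * J) *ᵥ (A *ᵥ E c) = 0 := by
      rw [← hP.dotProduct_mulVec_zero_iff, ← mulVec_mulVec]
      have : J *ᵥ (A *ᵥ E c) = A *ᵥ (J *ᵥ E c) := by
        rw [← hAA]; simp only [mulVec_mulVec, Matrix.mul_assoc]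
      rw [this, hmove, hJJE, mulVec_zero, dotProduct_zero]
    have h2 : G *ᵥ ((G * J) *ᵥ (A *ᵥ E c)) = 0 := by rw [h1, mulVec_zero]
    rwa [mulVec_mulVec, ← Matrix.mul_assoc, hG, modelGram_mul_self, Matrix.one_mul] at h2
  let L : (τ → ℂ) →ₗ[ℂ] ({a : α // μ a = 0 ∧ ε a = 1} → ℂ) :=
    LinearMap.funLeft ℂ ℂ (fun a => Sum.inl a.1) ∘ₗ A.mulVecLin ∘ₗ E
  have hLinj : Function.Injective L := by
    rw [injective_iff_map_eq_zero]
    intro c hc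
    set x := A *ᵥ E c with hx
    have hxa : ∀ a, μ a = 0 → ε a = 1 → x (Sum.inl a) = 0 := fun a h1 h2 =>
      congrFun hc ⟨a, h1, h2⟩
    have hxμ : ∀ a, (μ a : ℂ) * x (Sum.inl a) = 0 := fun a => by
      have := congrFun (hker c) (Sum.inl a)
      rw [hJ, modelJordan, fromBlocks_mulVec] at this
      simpa [mulVec_diagonal] using this
    have hxw : ∀ j, x (Sum.inr (Sum.inr j)) = 0 := fun j => by
      have := congrFun (hker c) (Sum.inr (Sum.inl j))
      rw [hJ, modelJordan, fromBlocks_mulVec] at this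
      simpa [fromBlocks_mulVec] using this
    have h1 : star x ⬝ᵥ (G *ᵥ x) = star c ⬝ᵥ c := by
      rw [hx, hmove, hJE, hE, hG, modelGram, fromBlocks_mulVec]
      simp [fromBlocks_mulVec, Function.comp_def, dotProduct]
    have h2 : star x ⬝ᵥ (G *ᵥ x) =
        ∑ a, ((ε a : ℤ) : ℂ) * (star (x (Sum.inl a)) * x (Sum.inl a)) := by
      rw [hG, modelGram, fromBlocks_mulVec]
      simp [fromBlocks_mulVec, dotProduct, mulVec_diagonal, hxw]
      exact Finset.sum_congr rfl fun a _ => by ring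
    -- Where the coordinate of `x` is nonzero, the sign is `-1`.
    have h3 : star x ⬝ᵥ (G *ᵥ x) ≤ 0 := by
      rw [h2]
      refine Finset.sum_nonpos fun a _ => ?_
      rcases Int.units_eq_one_or (ε a) with h | h
      · by_cases hμ : μ a = 0
        · simp [hxa a hμ h]
        · have : x (Sum.inl a) = 0 :=
            (mul_eq_zero.mp (hxμ a)).resolve_left (by exact_mod_cast hμ)
          simp [this]
      · have := star_mul_self_nonneg (x (Sum.inl a))
        rw [h]
        simpa using this
    rw [h1] at h3
    exact dotProduct_star_self_eq_zero.mp (le_antisymm h3 (dotProduct_star_self_nonneg c))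
  have := LinearMap.finrank_le_finrank_of_injective hLinj
  simpa [Nat.card_eq_fintype_card] using this

/-- A square root of the model operator: positive square roots on the eigenvectors, and each
nilpotent block `w ↦ v ↦ 0` is joined with a positive eigenvector `u` of eigenvalue zero to a chain
`w ↦ u ↦ v ↦ 0`. -/
theorem exists_sqrt_of_embedding {α τ : Type*} [Fintype α] [Fintype τ] [DecidableEq α]
    [DecidableEq τ] {μ : α → ℝ} {ε : α → ℤˣ} (hμ : ∀ a, 0 ≤ μ a)
    (f : τ ↪ {a : α // μ a = 0 ∧ ε a = 1}) :
    ∃ A, modelGram ε τ * A = Aᴴ * modelGram ε τ ∧ A * A = modelJordan μ τ := by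
  let F : Matrix α τ ℂ := Matrix.of fun a j => if a = (f j).1 then 1 else 0
  let R : Matrix α α ℂ := diagonal fun a => ((√(μ a) : ℝ) : ℂ)
  let S : Matrix α α ℂ := diagonal fun a => ((ε a : ℤ) : ℂ)
  have hRF : R * F = 0 := by
    ext a j
    simp only [R, F, diagonal_mul, of_apply, Matrix.zero_apply]
    split_ifs with h
    · simp [h, (f j).2.1]
    · simp
  have hSF : S * F = F := by
    ext a j
    simp only [S, F, diagonal_mul, of_apply]
    split_ifs with h
    · simp [h, (f j).2.2]
    · simp
  have hFF : Fᵀ * F = 1 := by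
    ext i j
    simp [F, Matrix.mul_apply, Matrix.one_apply, Subtype.val_inj, eq_comm (a := i)]
  have hFR : Fᵀ * R = 0 := by
    have := congrArg transpose hRF
    simpa [R] using this
  have hFS : Fᵀ * S = Fᵀ := by
    have := congrArg transpose hSF
    simpa [S] using this
  have hFH : Fᴴ = Fᵀ := by
    ext i j
    simp [F, conjTranspose_apply, apply_ite]
  have hRH : Rᴴ = R := by
    simp [R, diagonal_conjTranspose, Pi.star_def]
  have hRR : R * R = diagonal fun a => (μ a : ℂ) := by
    simp only [R, diagonal_mul_diagonal, ← Complex.ofReal_mul, Real.mul_self_sqrt (hμ _)]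
  have hRS : S * R = R * S := by
    simp [R, S, diagonal_mul_diagonal, mul_comm]
  refine ⟨fromBlocks R (fromCols 0 F) (fromRows Fᵀ 0) 0, ?_, ?_⟩
  · have hFT : Fᵀᴴ = F := by rw [← hFH, conjTranspose_conjTranspose]
    rw [modelGram, fromBlocks_conjTranspose, fromBlocks_multiply, fromBlocks_multiply]
    simp only [conjTranspose_fromCols_eq_fromRows_conjTranspose,
      conjTranspose_fromRows_eq_fromCols_conjTranspose]
    change fromBlocks (S * R + _) (S * _ + _) _ _ = fromBlocks (Rᴴ * S + _) _ (_ * S + _) _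
    simp [mul_fromCols, fromRows_mul, fromBlocks_mul_fromRows, fromCols_mul_fromBlocks,
      hFH, hRH, hFT, hSF, hFS, hRS]
  · rw [modelJordan, fromBlocks_multiply]
    simp [mul_fromCols, fromRows_mul, fromCols_mul_fromRows, hRF, hFR, hFF, hRR]
    ext (i | i) (j | j) <;> rfl

/-! ### Spectrum of an operator with a selfadjoint square root -/

theorem mem_spectrum_iff_exists_mulVec_eq {n : ℕ} (B : Matrix (Fin n) (Fin n) ℂ) (z : ℂ) :
    z ∈ spectrum ℂ B ↔ ∃ x, x ≠ 0 ∧ B *ᵥ x = z • x := by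
  rw [← Matrix.spectrum_toLin', ← Module.End.hasEigenvalue_iff_mem_spectrum]
  constructor
  · intro h
    obtain ⟨x, hx⟩ := h.exists_hasEigenvector
    exact ⟨x, hx.2, hx.apply_eq_smul⟩
  · rintro ⟨x, hx, hBx⟩
    exact Module.End.hasEigenvalue_of_hasEigenvector
      ⟨Module.End.mem_eigenspace_iff.mpr hBx, hx⟩

/-- If `A` is a selfadjoint square root of a nonnegative `B`, the form is nonnegative on the range
of `A`. An eigenvector of `B` with nonzero eigenvalue lies in that range, and its eigenvalue is a
quotient of two nonnegative numbers. -/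
theorem spectrum_subset_of_exists_sqrt {n : ℕ} {H B : Matrix (Fin n) (Fin n) ℂ}
    (hHinv : IsUnit H) (hP : (H * B).PosSemidef)
    (hA : ∃ A, H * A = Aᴴ * H ∧ A * A = B) :
    spectrum ℂ B ⊆ (fun r : ℝ => (r : ℂ)) '' Set.Ici 0 := by
  obtain ⟨A, hHA, hAA⟩ := hA
  intro z hz
  obtain ⟨x, hx, hBx⟩ := (mem_spectrum_iff_exists_mulVec_eq B z).mp hz
  by_cases hz0 : z = 0
  · exact ⟨0, Set.self_mem_Ici, by simp [hz0]⟩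
  have h1 : 0 ≤ z * (star x ⬝ᵥ (H *ᵥ x)) := by
    have := hP.dotProduct_mulVec_nonneg x
    rwa [← mulVec_mulVec, hBx, mulVec_smul, dotProduct_smul, smul_eq_mul] at this
  have h2 : 0 ≤ (star z * z) * (star x ⬝ᵥ (H *ᵥ x)) := by
    have h := hP.dotProduct_mulVec_nonneg (A *ᵥ x)
    have h3 : star (A *ᵥ x) ⬝ᵥ ((H * B) *ᵥ (A *ᵥ x)) = star (B *ᵥ x) ⬝ᵥ (H *ᵥ (B *ᵥ x)) := by
      have h4 : Aᴴ * (H * B * A) = Bᴴ * (H * B) := by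
        calc Aᴴ * (H * B * A) = Aᴴ * (H * A) * (A * A) := by
              rw [← hAA]; simp only [Matrix.mul_assoc]
          _ = (A * A)ᴴ * (H * (A * A)) := by
              rw [hHA, conjTranspose_mul]; simp only [Matrix.mul_assoc]
          _ = Bᴴ * (H * B) := by rw [hAA]
      rw [star_mulVec, star_mulVec, ← dotProduct_mulVec, ← dotProduct_mulVec]
      simp only [mulVec_mulVec]
      rw [h4]
    rw [h3, hBx, mulVec_smul, star_smul, smul_dotProduct, dotProduct_smul, smul_eq_mul,
      smul_eq_mul, ← mul_assoc] at h
    exact h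
  have h3 : star x ⬝ᵥ (H *ᵥ x) ≠ 0 := by
    intro h0
    have h4 : star x ⬝ᵥ ((H * B) *ᵥ x) = 0 := by
      rw [← mulVec_mulVec, hBx, mulVec_smul, dotProduct_smul, h0, smul_zero]
    rw [hP.dotProduct_mulVec_zero_iff, ← mulVec_mulVec] at h4
    have h5 : B *ᵥ x = 0 := Matrix.mulVec_injective_of_isUnit hHinv (by simpa using h4)
    rw [hBx] at h5
    exact (smul_ne_zero hz0 hx) h5
  have h4 : 0 < star z * z := lt_of_le_of_ne (star_mul_self_nonneg z)
    (mul_ne_zero (star_ne_zero.mpr hz0) hz0).symm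
  have h5 : 0 < star x ⬝ᵥ (H *ᵥ x) :=
    lt_of_le_of_ne (le_of_mul_le_mul_left (by simpa using h2) h4) h3.symm
  have h6 : 0 ≤ z := le_of_mul_le_mul_right (by simpa using h1) h5
  exact ⟨z.re, (Complex.nonneg_iff.mp h6).1, Complex.ext rfl (Complex.nonneg_iff.mp h6).2⟩

/-! ### Existence of the canonical form and the criterion -/

/-- A pair equivalent to a model pair has a canonical form, with the blocks numbered by `Fin`. -/
theorem exists_isCanonicalFormOf {n : ℕ} {H B : Matrix (Fin n) (Fin n) ℂ} {α τ : Type}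
    [Fintype α] [Fintype τ] [DecidableEq α] [DecidableEq τ] {μ : α → ℝ} {ε : α → ℤˣ}
    (h : PairEquiv B H (modelJordan μ τ) (modelGram ε τ)) :
    ∃ D : CanonicalData, D.IsCanonicalFormOf B H := by
  let e := (Fintype.equivFin (α ⊕ τ)).symm
  let D : CanonicalData :=
    { numReal := Fintype.card (α ⊕ τ)
      size := fun i => Sum.elim (fun _ => 1) (fun _ => 2) (e i)
      size_pos := fun i => by rcases e i with a | j <;> simp
      eig := fun i => Sum.elim μ (fun _ => 0) (e i)
      sign := fun i => Sum.elim ε (fun _ => 1) (e i)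
      numPairs := 0
      csize := Fin.elim0
      csize_pos := fun j => j.elim0
      ceig := Fin.elim0
      ceig_im_pos := fun j => j.elim0 }
  obtain ⟨g, hgJ, hgG⟩ := D.exists_equiv_model e.symm rfl (by simp [D]) (by simp [D])
    (by simp [D]) (by simp [D])
  refine ⟨D, (D.isCanonicalFormOf_iff_pairEquiv B H).mpr ?_⟩
  have hμ : (fun a => D.eig (e.symm (Sum.inl a))) = μ := by funext a; simp [D]
  have hε : (fun a => D.sign (e.symm (Sum.inl a))) = ε := by funext a; simp [D]
  rw [hμ] at hgJ
  rw [hε] at hgG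
  rw [← hgJ, ← hgG] at h
  simpa using h.reindex g.symm

theorem mainTheorem1 (n : ℕ) (H B : Matrix (Fin n) (Fin n) ℂ)
    (hH : H.IsHermitian) (hHinv : IsUnit H) (hB : IsHNonneg H B) :
    (∃ D : CanonicalData, D.IsCanonicalFormOf B H) ∧
    ∀ D : CanonicalData, D.IsCanonicalFormOf B H →
      ((∃ A : Matrix (Fin n) (Fin n) ℂ, IsHSelfadjoint H A ∧ A ^ 2 = B) ↔
        (spectrum ℂ B ⊆ (fun r : ℝ => (r : ℂ)) '' Set.Ici 0 ∧ D.numSizeTwo ≤ D.sPlus)) := by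
  have hP := hB.posSemidef
  constructor
  · obtain ⟨α, τ, _, _, _, _, μ, ε, h⟩ := exists_pairEquiv_model hH hHinv hP
    exact exists_isCanonicalFormOf h
  intro D hD
  rw [D.isCanonicalFormOf_iff_pairEquiv] at hD
  have hblocks := D.size_eq_one_or_size_eq_two (hD.posSemidef hP)
  have htwo : ∀ i, ¬ D.size i = 1 → D.size i = 2 ∧ D.eig i = 0 ∧ D.sign i = 1 :=
    fun i hi => (hblocks i).resolve_left hi
  obtain ⟨g, hgJ, hgG⟩ := D.exists_equiv_model
    (Equiv.sumCompl fun i : Fin D.numReal => D.size i = 1)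
    (D.numPairs_eq_zero (hD.posSemidef hP)) (fun a => a.2) (fun j => (htwo _ j.2).1)
    (fun j => (htwo _ j.2).2.1) (fun j => (htwo _ j.2).2.2)
  have hM := hD.reindex g
  rw [hgJ, hgG] at hM
  simp only [Equiv.sumCompl_apply_inl] at hM
  have ht : D.numSizeTwo = Fintype.card {i : Fin D.numReal // ¬ D.size i = 1} := by
    rw [CanonicalData.numSizeTwo, ← Nat.card_eq_fintype_card]
    refine congrArg Set.ncard (Set.ext fun i => ?_)
    exact ⟨fun h h1 => by rw [Set.mem_ofPred_eq, h1] at h; exact absurd h.1 (by norm_num),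
      fun h => ⟨(htwo i h).1, (htwo i h).2.1⟩⟩
  have hs : D.sPlus = Nat.card {a : {i : Fin D.numReal // D.size i = 1} //
      D.eig a.1 = 0 ∧ D.sign a.1 = 1} :=
    (Nat.card_congr (Equiv.subtypeSubtypeEquivSubtypeInter
      (fun i : Fin D.numReal => D.size i = 1) (fun i => D.eig i = 0 ∧ D.sign i = 1))).symm
  simp only [IsHSelfadjoint, pow_two]
  rw [ht, hs]
  constructor
  · intro hA
    exact ⟨spectrum_subset_of_exists_sqrt hHinv hP hA,
      card_le_of_exists_sqrt (hM.posSemidef hP) (hM.exists_sqrt hA)⟩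
  · rintro ⟨hspec, hle⟩
    rw [Nat.card_eq_fintype_card] at hle
    obtain ⟨f⟩ := Function.Embedding.nonempty_of_card_le hle
    -- The eigenvalues of the model are eigenvalues of `B`, hence nonnegative.
    refine hM.symm.exists_sqrt (exists_sqrt_of_embedding (fun a => ?_) f)
    obtain ⟨y, hy, hBy⟩ := hM.mulVec_eigenvector (x := Pi.single (Sum.inl a) 1)
      (z := (D.eig a.1 : ℂ)) (by simp) (by
        ext (b | b | b)
        · by_cases h : b = a
          · subst h; simp [modelJordan]
          · simp [modelJordan, h]
        · simp [modelJordan]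
        · simp [modelJordan])
    obtain ⟨r, hr, hr2⟩ := hspec ((mem_spectrum_iff_exists_mulVec_eq B _).mpr ⟨y, hy, hBy⟩)
    have : r = D.eig a.1 := Complex.ofReal_injective hr2
    exact this ▸ hr
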